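/- For $d,n\ge 0$ let $Q^d_n$ be the $d$-dimensional queen graph: its vertices are the cells of $\{0,1,\dots,n-1\}^d$, and two distinct cells $v,w$ are adjacent if $w=v+ku$ for some integer $k$ and some direction $u\in\{-1,0,1\}^d$ (so $Q^2_n$ is the usual queen graph of the $n\times n$ chessboard, and in $Q^3_n$ a queen moves along the 13 lines through a cell that are parallel to an axis, a face diagonal or a space diagonal). Let $\gamma(G)$ be the domination number of a finite graph $G$, that is, the minimum cardinality of a set $S$ of vertices such that every vertex lies in $S$ or is adjacent to an element of $S$. Then $$\gamma(Q^3_n)\;\le\; n\cdot\gamma(Q^2_n)\;\le\;\tfrac{69}{133}\,n^2+O(n).$$ That is, $\gamma(Q^3_n)\le n\cdot\gamma(Q^2_n)$ for every $n$, and there is an absolute constant $C$ such that $n\cdot\gamma(Q^2_n)\le\tfrac{69}{133}n^2+Cn$ for every $n$. -/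

import Mathlib

/-- The `d`-dimensional queen graph on the board `{0, …, n-1}^d`. Two distinct cells are adjacent
if they differ by an integer number `k` of steps in a direction `u ∈ {-1, 0, 1}^d`. Since the cells
are distinct, `u` and `k` are nonzero; for `d = 2` this leaves 4 undirected line families through
a cell (the moves of the chess queen), and for `d = 3` it leaves 13. -/
def queenGraph (d n : ℕ) : SimpleGraph (Fin d → Fin n) where
  Adj v w := v ≠ w ∧ ∃ u : Fin d → ℤ, (∀ i, u i = -1 ∨ u i = 0 ∨ u i = 1) ∧
    ∃ k : ℤ, ∀ i, ((w i : ℕ) : ℤ) = ((v i : ℕ) : ℤ) + k * u i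
  symm := ⟨by
    rintro v w ⟨hne, u, hu, k, hk⟩
    exact ⟨hne.symm, u, hu, -k, fun i => by rw [hk i]; ring⟩⟩
  loopless := ⟨fun _ h => h.1 rfl⟩

/-- `S` is a dominating set of `G`: the closed neighbourhoods of its elements cover all vertices. -/
def IsDominatingSet {V : Type*} (G : SimpleGraph V) (S : Finset V) : Prop :=
  ⋃ v ∈ S, ({v} ∪ G.neighborSet v) = Set.univ

/-- The domination number of a graph on finitely many vertices: the minimum cardinality of a
dominating set. The set of these cardinalities is nonempty, as all vertices form a dominating
set. -/
noncomputable def dominationNumber {V : Type*} [Fintype V] (G : SimpleGraph V) : ℕ :=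
  sInf {k : ℕ | ∃ S : Finset V, IsDominatingSet G S ∧ S.card = k}

/-!
The first inequality holds because copies of a planar dominating set in all `n` layers dominate the
cube. The second one is a linear bound for the planar board, and the construction below gives
`γ(Q_n) ≤ (64/124) n + O(1)`, where `64/124 < 69/133`.

Put the origin in the centre of a board of side `4A + 3` and place queens only on squares
`(2x, 2y)`. If all even columns and rows are occupied, only squares with two odd coordinates
remain, and these have to be covered by diagonals
(`dominationNumber_queenGraph_two_le_of_even_squares`). In terms of `δ = x - y` and `σ = x + y`,
a remaining square has `δ`, `σ` of opposite parity and `|δ| + |σ| ≤ 2A + 1`. Hence it suffices to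
occupy the differences and the sums that are even and at most `e`, or odd and at most `f`, in
absolute value, where `e + f` is about `2A`.

The queens are obtained by scaling a fixed `coarsePattern` of 63 cells, with `e = 14` and `f = 47`,
by an odd factor `q = 12r + 1`, and replacing each cell by a `queenBlock` of `q` queens on the lines
`j ≡ 2i` modulo `q`. Since `i - j` is even throughout the block and `q` is odd, the parity of a
diagonal is the parity of the coarse diagonal it comes from. The columns and the differences of a
block fill exactly one period. By the parallelogram law
`(i - j)² + (i + j)² = 2i² + 2j²` this is impossible for rows and sums at the same time, and these
spill over into the neighbouring periods. The spilling is harmless in the interior, where it is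
compensated by the neighbouring blocks. At the boundary it costs some sum diagonals, which are not
needed for `A = 31q - 1`, and some rows, which are covered by `cornerQueens`
together with the outermost columns. In total `64q - 1` queens dominate the board of side
`124q - 1` (`dominationNumber_queenGraph_two_le_of_ge`). For the sides in between, one more
queen per additional row and column suffices.
-/

/-! ### Dominating sets of queen graphs -/

theorem isDominatingSet_iff {V : Type*} (G : SimpleGraph V) (S : Finset V) :
    IsDominatingSet G S ↔ ∀ w, ∃ v ∈ S, w = v ∨ G.Adj v w := by
  simp [IsDominatingSet, Set.eq_univ_iff_forall]

theorem dominationNumber_le {V : Type*} [Fintype V] {G : SimpleGraph V} {S : Finset V}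
    (h : IsDominatingSet G S) : dominationNumber G ≤ S.card :=
  Nat.sInf_le ⟨S, h, rfl⟩

theorem exists_isDominatingSet_card_eq {V : Type*} [Fintype V] (G : SimpleGraph V) :
    ∃ S : Finset V, IsDominatingSet G S ∧ S.card = dominationNumber G :=
  Nat.sInf_mem (s := {k : ℕ | ∃ S : Finset V, IsDominatingSet G S ∧ S.card = k})
    ⟨_, Finset.univ, (isDominatingSet_iff _ _).2 fun w => ⟨w, Finset.mem_univ w, Or.inl rfl⟩, rfl⟩

/-- Stacking a copy of a dominating set of the square board in each of the `n` layers of the cube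
dominates the cube: a planar move is a spatial move with vertical component `0`. -/
theorem dominationNumber_queenGraph_three_le (n : ℕ) :
    dominationNumber (queenGraph 3 n) ≤ n * dominationNumber (queenGraph 2 n) := by
  classical
  obtain ⟨S, hS, hcard⟩ := exists_isDominatingSet_card_eq (queenGraph 2 n)
  rw [isDominatingSet_iff] at hS
  have hdom : IsDominatingSet (queenGraph 3 n)
      ((Finset.univ ×ˢ S).image fun p : Fin n × (Fin 2 → Fin n) => ![p.2 0, p.2 1, p.1]) := by
    rw [isDominatingSet_iff]
    intro w
    obtain ⟨v, hv, h⟩ := hS ![w 0, w 1]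
    refine ⟨![v 0, v 1, w 2], Finset.mem_image.2 ⟨(w 2, v), by simp [hv], rfl⟩, ?_⟩
    by_cases hw : w = ![v 0, v 1, w 2]
    · exact Or.inl hw
    refine Or.inr ⟨Ne.symm hw, ?_⟩
    rcases h with h | ⟨-, u, hu, k, hk⟩
    · refine absurd ?_ hw
      have h0 := congrFun h 0
      have h1 := congrFun h 1
      ext i
      fin_cases i <;> simp_all
    · refine ⟨![u 0, u 1, 0], fun i => ?_, k, fun i => ?_⟩
      · fin_cases i
        · exact hu 0
        · exact hu 1
        · simp
      · have h0 := hk 0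
        have h1 := hk 1
        fin_cases i <;> simp_all
  calc _ ≤ _ := dominationNumber_le hdom
    _ ≤ _ := Finset.card_image_le
    _ = _ := by simp [hcard]

/-- Coordinate form of domination on the square board: it suffices that every cell shares a
column, a row, a difference diagonal or a sum diagonal with a queen. -/
theorem dominationNumber_queenGraph_two_le {n : ℕ} (S : Finset (ℤ × ℤ))
    (hS : ∀ p ∈ S, (0 ≤ p.1 ∧ p.1 < n) ∧ 0 ≤ p.2 ∧ p.2 < n)
    (h : ∀ x y : ℤ, 0 ≤ x → x < n → 0 ≤ y → y < n →
      ∃ p ∈ S, p.1 = x ∨ p.2 = y ∨ p.1 - p.2 = x - y ∨ p.1 + p.2 = x + y) :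
    dominationNumber (queenGraph 2 n) ≤ S.card := by
  classical
  have hdom : IsDominatingSet (queenGraph 2 n) (S.attach.image fun p =>
      ![⟨p.1.1.toNat, by have := hS _ p.2; omega⟩, ⟨p.1.2.toNat, by have := hS _ p.2; omega⟩]) := by
    rw [isDominatingSet_iff]
    intro w
    obtain ⟨p, hp, hpw⟩ := h (w 0) (w 1) (by simp) (by simp) (by simp) (by simp)
    have hb := hS p hp
    refine ⟨_, Finset.mem_image.2 ⟨⟨p, hp⟩, Finset.mem_attach _ _, rfl⟩, ?_⟩
    refine or_iff_not_imp_left.2 fun hne => ⟨Ne.symm hne, ?_⟩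
    have e1 : ((p.1.toNat : ℕ) : ℤ) = p.1 := Int.toNat_of_nonneg hb.1.1
    have e2 : ((p.2.toNat : ℕ) : ℤ) = p.2 := Int.toNat_of_nonneg hb.2.1
    rcases hpw with e | e | e | e
    · refine ⟨![0, 1], fun i => by fin_cases i <;> simp, (w 1 : ℕ) - p.2, fun i => ?_⟩
      fin_cases i <;> simp [hb]; omega
    · refine ⟨![1, 0], fun i => by fin_cases i <;> simp, (w 0 : ℕ) - p.1, fun i => ?_⟩
      fin_cases i <;> simp [hb]; omega
    · refine ⟨![1, 1], fun i => by fin_cases i <;> simp, (w 0 : ℕ) - p.1, fun i => ?_⟩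
      fin_cases i <;> simp [hb]; omega
    · refine ⟨![1, -1], fun i => by fin_cases i <;> simp, (w 0 : ℕ) - p.1, fun i => ?_⟩
      fin_cases i <;> simp [hb]; omega
  calc _ ≤ _ := dominationNumber_le hdom
    _ ≤ _ := Finset.card_image_le
    _ = _ := Finset.card_attach

/-- A finite set of pairs `(x, y)` stands for queens on the squares `(2x, 2y)` of the board
`{-(2A+1), …, 2A+1}²`. If these queens occupy all even columns and rows, only the squares with two
odd coordinates `2X+1, 2Y+1` depend on diagonals, and `δ = X - Y`, `σ = X + Y + 1` are then of
opposite parity with `|δ| + |σ| ≤ 2A + 1`. The board of side `4A + 3` is enlarged to side `n` by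
one further queen for each additional row and column. -/
theorem dominationNumber_queenGraph_two_le_of_even_squares {A n : ℕ} (hn : 4 * A + 3 ≤ n)
    (S : Finset (ℤ × ℤ)) (hS : ∀ p ∈ S, |p.1| ≤ A ∧ |p.2| ≤ A)
    (hcol : ∀ x : ℤ, |x| ≤ A → ∃ p ∈ S, p.1 = x)
    (hrow : ∀ y : ℤ, |y| ≤ A → ∃ p ∈ S, p.2 = y)
    (hdiag : ∀ δ σ : ℤ, |δ| + |σ| ≤ 2 * A + 1 → (δ + σ) % 2 = 1 →
      ∃ p ∈ S, p.1 - p.2 = δ ∨ p.1 + p.2 = σ) :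
    dominationNumber (queenGraph 2 n) ≤ S.card + (n - (4 * A + 3)) := by
  classical
  refine (dominationNumber_queenGraph_two_le
    (S.image (fun p => (2 * p.1 + 2 * A + 1, 2 * p.2 + 2 * A + 1)) ∪
      (Finset.Ico (4 * A + 3 : ℤ) n).image fun t => (t, t)) ?_ ?_).trans ?_
  · intro p hp
    rcases Finset.mem_union.1 hp with hp | hp
    · obtain ⟨s, hs, rfl⟩ := Finset.mem_image.1 hp
      have := hS s hs
      simp only [abs_le] at this
      dsimp only
      omega
    · obtain ⟨t, ht, rfl⟩ := Finset.mem_image.1 hp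
      rw [Finset.mem_Ico] at ht
      dsimp only
      omega
  · intro x y hx0 hxn hy0 hyn
    by_cases hx : 4 * (A : ℤ) + 3 ≤ x
    · exact ⟨(x, x), Finset.mem_union_right _ (Finset.mem_image.2
        ⟨x, Finset.mem_Ico.2 ⟨hx, hxn⟩, rfl⟩), Or.inl rfl⟩
    by_cases hy : 4 * (A : ℤ) + 3 ≤ y
    · exact ⟨(y, y), Finset.mem_union_right _ (Finset.mem_image.2
        ⟨y, Finset.mem_Ico.2 ⟨hy, hyn⟩, rfl⟩), Or.inr (Or.inl rfl)⟩
    suffices ∃ p ∈ S, 2 * p.1 + 2 * A + 1 = x ∨ 2 * p.2 + 2 * A + 1 = y ∨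
        2 * p.1 - 2 * p.2 = x - y ∨ 2 * p.1 + 2 * p.2 + 4 * A + 2 = x + y by
      obtain ⟨p, hp, h⟩ := this
      refine ⟨_, Finset.mem_union_left _ (Finset.mem_image.2 ⟨p, hp, rfl⟩), ?_⟩
      dsimp only
      omega
    by_cases hx2 : x % 2 = 1
    · obtain ⟨p, hp, h⟩ := hcol ((x - 2 * A - 1) / 2) (by rw [abs_le]; omega)
      exact ⟨p, hp, by omega⟩
    by_cases hy2 : y % 2 = 1
    · obtain ⟨p, hp, h⟩ := hrow ((y - 2 * A - 1) / 2) (by rw [abs_le]; omega)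
      exact ⟨p, hp, by omega⟩
    obtain ⟨p, hp, h⟩ := hdiag (x / 2 - y / 2) (x / 2 + y / 2 - 2 * A - 1)
      (by rcases abs_cases (x / 2 - y / 2) with h | h <;>
          rcases abs_cases (x / 2 + y / 2 - 2 * (A : ℤ) - 1) with h' | h' <;> omega) (by omega)
    exact ⟨p, hp, by omega⟩
  · refine (Finset.card_union_le _ _).trans (Nat.add_le_add Finset.card_image_le ?_)
    refine Finset.card_image_le.trans ?_
    rw [Int.card_Ico]
    omega

/-! ### The coarse pattern -/

/-- Representatives, up to central symmetry, of the nonzero cells of `coarsePattern`. -/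
def coarseHalf : List (ℤ × ℤ) :=
  [(8, -2), (2, 10), (5, -9), (7, 1), (5, -7), (9, 5), (6, 4), (4, 29), (15, 30), (11, 28),
   (30, -7), (25, -6), (1, -22), (22, 3), (28, -11), (21, 8), (3, 24), (10, -25), (19, -26),
   (27, -14), (29, -18), (13, -16), (14, -13), (12, -21), (26, 17), (17, 20), (24, -19),
   (23, 12), (16, 15), (20, 27), (18, 23)]

/-- A centrally symmetric set of 63 cells in `{-30, …, 30}²`. It meets every column and every row
of that box, and its difference and its sum diagonals are exactly the even ones up to `14` and the
odd ones up to `47` in absolute value. -/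
def coarsePattern : List (ℤ × ℤ) :=
  (0, 0) :: (coarseHalf ++ coarseHalf.map fun p => (-p.1, -p.2))

theorem length_coarsePattern : coarsePattern.length = 63 := rfl

theorem coarsePattern_bound : ∀ p ∈ coarsePattern, |p.1| ≤ 30 ∧ |p.2| ≤ 30 := by
  decide +kernel

theorem exists_coarse_col {a : ℤ} (h : |a| ≤ 30) : ∃ b, (a, b) ∈ coarsePattern := by
  have key : ∀ k : Fin 61, ∃ p ∈ coarsePattern, p.1 = (k : ℕ) - 30 := by decide +kernel
  rw [abs_le] at h
  obtain ⟨p, hp, e⟩ := key ⟨(a + 30).toNat, by omega⟩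
  obtain rfl : p.1 = a := by rw [e]; dsimp only; omega
  exact ⟨p.2, hp⟩

theorem exists_coarse_row {b : ℤ} (h : |b| ≤ 30) : ∃ a, (a, b) ∈ coarsePattern := by
  have key : ∀ k : Fin 61, ∃ p ∈ coarsePattern, p.2 = (k : ℕ) - 30 := by decide +kernel
  rw [abs_le] at h
  obtain ⟨p, hp, e⟩ := key ⟨(b + 30).toNat, by omega⟩
  obtain rfl : p.2 = b := by rw [e]; dsimp only; omega
  exact ⟨p.1, hp⟩

theorem exists_coarse_diff {c : ℤ} (h : |c| ≤ 47) (hc : c % 2 = 1 ∨ |c| ≤ 14) :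
    ∃ a b, (a, b) ∈ coarsePattern ∧ a - b = c := by
  have key : ∀ k : Fin 95, ((k : ℕ) : ℤ) % 2 = 0 ∨ |((k : ℕ) : ℤ) - 47| ≤ 14 →
      ∃ p ∈ coarsePattern, p.1 - p.2 = (k : ℕ) - 47 := by decide +kernel
  rw [abs_le] at h hc
  obtain ⟨p, hp, e⟩ := key ⟨(c + 47).toNat, by omega⟩ (by rw [abs_le]; dsimp only; omega)
  exact ⟨p.1, p.2, hp, by rw [e]; dsimp only; omega⟩

theorem exists_coarse_sum {c : ℤ} (h : |c| ≤ 47) (hc : c % 2 = 1 ∨ |c| ≤ 14) :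
    ∃ a b, (a, b) ∈ coarsePattern ∧ a + b = c := by
  have key : ∀ k : Fin 95, ((k : ℕ) : ℤ) % 2 = 0 ∨ |((k : ℕ) : ℤ) - 47| ≤ 14 →
      ∃ p ∈ coarsePattern, p.1 + p.2 = (k : ℕ) - 47 := by decide +kernel
  rw [abs_le] at h hc
  obtain ⟨p, hp, e⟩ := key ⟨(c + 47).toNat, by omega⟩ (by rw [abs_le]; dsimp only; omega)
  exact ⟨p.1, p.2, hp, by rw [e]; dsimp only; omega⟩

-- Only the facts above are used; unfolding the explicit list in unification is expensive.
attribute [irreducible] coarsePattern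

/-! ### The block replacing a coarse cell -/

/-- The block of `12r + 1` queens replacing a coarse cell. With `q = 12r + 1` it consists of
the points `(i, j)`, `|i| ≤ 6r`, with `j ≡ 2i` modulo `q` and `|j| < q`, where `j` is chosen such
that `i - j` is even. Then `i - j` runs through the even numbers between `-q` and `q`, and `j` and
`i + j` run through all residues modulo `q`. -/
noncomputable def queenBlock (r : ℕ) : Finset (ℤ × ℤ) :=
  (Finset.Icc (-3 * r : ℤ) (3 * r)).image (fun u => (2 * u, 4 * u)) ∪
  ((Finset.Icc (1 : ℤ) (3 * r)).image (fun u => (2 * u - 1, 4 * u - 3 - 12 * r)) ∪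
  (Finset.Icc (1 : ℤ) (3 * r)).image (fun u => (1 - 2 * u, 3 + 12 * r - 4 * u)))

theorem mem_queenBlock {r : ℕ} {p : ℤ × ℤ} : p ∈ queenBlock r ↔
    (∃ u : ℤ, (-3 * r ≤ u ∧ u ≤ 3 * r) ∧ (2 * u, 4 * u) = p) ∨
    (∃ u : ℤ, (1 ≤ u ∧ u ≤ 3 * r) ∧ (2 * u - 1, 4 * u - 3 - 12 * r) = p) ∨
    ∃ u : ℤ, (1 ≤ u ∧ u ≤ 3 * r) ∧ (1 - 2 * u, 3 + 12 * r - 4 * u) = p := by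
  simp only [queenBlock, Finset.mem_union, Finset.mem_image, Finset.mem_Icc]

theorem card_queenBlock_le (r : ℕ) : (queenBlock r).card ≤ 12 * r + 1 := by
  refine (Finset.card_union_le _ _).trans ((Nat.add_le_add Finset.card_image_le
    ((Finset.card_union_le _ _).trans
      (Nat.add_le_add Finset.card_image_le Finset.card_image_le))).trans ?_)
  simp only [Int.card_Icc]
  omega

theorem queenBlock_bound {r : ℕ} {p : ℤ × ℤ} (hp : p ∈ queenBlock r) :
    |p.1| ≤ 6 * r ∧ |p.2| ≤ 12 * r := by
  rw [abs_le, abs_le]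
  rcases mem_queenBlock.1 hp with ⟨u, hu, rfl⟩ | ⟨u, hu, rfl⟩ | ⟨u, hu, rfl⟩ <;> dsimp only <;> omega

theorem exists_block_col {r : ℕ} {i : ℤ} (h : |i| ≤ 6 * r) : ∃ j, (i, j) ∈ queenBlock r := by
  rw [abs_le] at h
  simp only [mem_queenBlock, Prod.mk.injEq]
  by_cases hi : i % 2 = 0
  · exact ⟨_, Or.inl ⟨i / 2, by omega, by omega, rfl⟩⟩
  by_cases hpos : 0 < i
  · exact ⟨_, Or.inr (Or.inl ⟨(i + 1) / 2, by omega, by omega, rfl⟩)⟩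
  · exact ⟨_, Or.inr (Or.inr ⟨(1 - i) / 2, by omega, by omega, rfl⟩)⟩

/-- A row residue `0 ≤ t < q` is represented in the block by `t` itself if `t ≡ 0, 3` modulo `4`,
and by `t - q` if `t ≡ 1, 2` modulo `4`. -/
theorem exists_block_row {r : ℕ} {t : ℤ} (h0 : 0 ≤ t) (h1 : t ≤ 12 * r) :
    ((t % 4 = 0 ∨ t % 4 = 3) ∧ ∃ i, (i, t) ∈ queenBlock r) ∨
    ((t % 4 = 1 ∨ t % 4 = 2) ∧ ∃ i, (i, t - (12 * r + 1)) ∈ queenBlock r) := by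
  simp only [mem_queenBlock, Prod.mk.injEq]
  have h4 : t % 4 = 0 ∨ t % 4 = 1 ∨ t % 4 = 2 ∨ t % 4 = 3 := by omega
  rcases h4 with h | h | h | h
  · exact Or.inl ⟨Or.inl h, _, Or.inl ⟨t / 4, by omega, rfl, by omega⟩⟩
  · exact Or.inr ⟨Or.inl h, _, Or.inl ⟨(t - (12 * r + 1)) / 4, by omega, rfl, by omega⟩⟩
  · exact Or.inr ⟨Or.inr h, _, Or.inr (Or.inl ⟨(t + 2) / 4, by omega, rfl, by omega⟩)⟩
  · exact Or.inl ⟨Or.inr h, _, Or.inr (Or.inr ⟨(3 + 12 * r - t) / 4, by omega, rfl, by omega⟩)⟩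

theorem exists_block_diff {r : ℕ} {s : ℤ} (hs : s % 2 = 0) (h : |s| ≤ 12 * r) :
    ∃ i j, (i, j) ∈ queenBlock r ∧ i - j = s := by
  rw [abs_le] at h
  simp only [mem_queenBlock, Prod.mk.injEq]
  by_cases h1 : 6 * r < s
  · exact ⟨_, _, Or.inr (Or.inl ⟨(2 + 12 * r - s) / 2, by omega, rfl, rfl⟩), by omega⟩
  by_cases h2 : s < -(6 * r)
  · exact ⟨_, _, Or.inr (Or.inr ⟨(2 + 12 * r + s) / 2, by omega, rfl, rfl⟩), by omega⟩
  · exact ⟨_, _, Or.inl ⟨-s / 2, by omega, rfl, rfl⟩, by omega⟩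

/-- An even number `s` between `-q` and `q` is, up to a shift by `2q` towards the other sign, the
sum of the coordinates of a point of the block. -/
theorem exists_block_sum {r : ℕ} {s : ℤ} (hs : s % 2 = 0) (h : |s| ≤ 12 * r) :
    ∃ i j, (i, j) ∈ queenBlock r ∧ (i + j = s ∨ (0 < s ∧ i + j = s - 2 * (12 * r + 1)) ∨
      (s < 0 ∧ i + j = s + 2 * (12 * r + 1))) := by
  rw [abs_le] at h
  simp only [mem_queenBlock, Prod.mk.injEq]
  have h6 : s % 6 = 0 ∨ s % 6 = 2 ∨ s % 6 = 4 := by omega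
  rcases h6 with h6 | h6 | h6
  · exact ⟨_, _, Or.inl ⟨s / 6, by omega, rfl, rfl⟩, by omega⟩
  · by_cases h1 : 6 * r < s
    · exact ⟨_, _, Or.inl ⟨(s - 2 * (12 * r + 1)) / 6, by omega, rfl, rfl⟩, by omega⟩
    · exact ⟨_, _, Or.inr (Or.inl ⟨(s + 12 * r + 4) / 6, by omega, rfl, rfl⟩), by omega⟩
  · by_cases h1 : s < -(6 * r)
    · exact ⟨_, _, Or.inl ⟨(s + 2 * (12 * r + 1)) / 6, by omega, rfl, rfl⟩, by omega⟩
    · exact ⟨_, _, Or.inr (Or.inr ⟨(12 * r + 4 - s) / 6, by omega, rfl, rfl⟩), by omega⟩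

/-! ### The queens on the even squares -/

/-- Queens in the corners of the box `|x|, |y| < 31q`, `q = 12r + 1`, one on each row and each
column of that box that the blocks miss: the columns `x` with `30q + 6r < |x|`, and the rows
`±(30q + t)` with `0 < t < q` and `t ≡ 1, 2` modulo `4`. -/
noncomputable def cornerQueens (r : ℕ) : Finset (ℤ × ℤ) :=
  ((Finset.range (3 * r)).image fun t : ℕ =>
    (30 * (12 * r + 1) + 6 * r + 1 + t, 30 * (12 * r + 1) + 4 * t + 1)) ∪
  ((Finset.range (3 * r)).image fun t : ℕ =>
    (30 * (12 * r + 1) + 9 * r + 1 + t, 30 * (12 * r + 1) + 4 * t + 2)) ∪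
  (((Finset.range (3 * r)).image fun t : ℕ =>
    (-(30 * (12 * r + 1) + 6 * r + 1 + t), -(30 * (12 * r + 1) + 4 * t + 1))) ∪
  ((Finset.range (3 * r)).image fun t : ℕ =>
    (-(30 * (12 * r + 1) + 9 * r + 1 + t), -(30 * (12 * r + 1) + 4 * t + 2))))

theorem mem_cornerQueens {r : ℕ} {p : ℤ × ℤ} : p ∈ cornerQueens r ↔
    ((∃ t : ℕ, t < 3 * r ∧
      ((30 * (12 * r + 1) + 6 * r + 1 + t, 30 * (12 * r + 1) + 4 * t + 1) : ℤ × ℤ) = p) ∨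
    ∃ t : ℕ, t < 3 * r ∧
      ((30 * (12 * r + 1) + 9 * r + 1 + t, 30 * (12 * r + 1) + 4 * t + 2) : ℤ × ℤ) = p) ∨
    (∃ t : ℕ, t < 3 * r ∧
      ((-(30 * (12 * r + 1) + 6 * r + 1 + t), -(30 * (12 * r + 1) + 4 * t + 1)) : ℤ × ℤ) = p) ∨
    ∃ t : ℕ, t < 3 * r ∧
      ((-(30 * (12 * r + 1) + 9 * r + 1 + t), -(30 * (12 * r + 1) + 4 * t + 2)) : ℤ × ℤ) = p := by
  simp only [cornerQueens, Finset.mem_union, Finset.mem_image, Finset.mem_range]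

theorem card_cornerQueens_le (r : ℕ) : (cornerQueens r).card ≤ 12 * r := by
  have h (f : ℕ → ℤ × ℤ) : ((Finset.range (3 * r)).image f).card ≤ 3 * r :=
    Finset.card_image_le.trans (Finset.card_range _).le
  refine (Finset.card_union_le _ _).trans ((Nat.add_le_add
    ((Finset.card_union_le _ _).trans (Nat.add_le_add (h _) (h _)))
    ((Finset.card_union_le _ _).trans (Nat.add_le_add (h _) (h _)))).trans ?_)
  omega

theorem cornerQueens_bound {r : ℕ} {p : ℤ × ℤ} (hp : p ∈ cornerQueens r) :
    |p.1| ≤ 31 * (12 * r + 1) - 1 ∧ |p.2| ≤ 31 * (12 * r + 1) - 1 := by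
  rw [abs_le, abs_le]
  rcases mem_cornerQueens.1 hp with
    (⟨t, ht, rfl⟩ | ⟨t, ht, rfl⟩) | ⟨t, ht, rfl⟩ | ⟨t, ht, rfl⟩ <;> dsimp only <;> omega

theorem exists_corner_col {r : ℕ} {x : ℤ} (h0 : 30 * (12 * r + 1) + 6 * r < |x|)
    (h1 : |x| ≤ 31 * (12 * r + 1) - 1) : ∃ p ∈ cornerQueens r, p.1 = x := by
  simp only [mem_cornerQueens]
  rcases abs_cases x with ⟨e, -⟩ | ⟨e, -⟩ <;> rw [e] at h0 h1
  · by_cases h : x ≤ 30 * (12 * r + 1) + 9 * r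
    · exact ⟨_, Or.inl (Or.inl ⟨(x - (30 * (12 * r + 1) + 6 * r + 1)).toNat, by omega, rfl⟩),
        by omega⟩
    · exact ⟨_, Or.inl (Or.inr ⟨(x - (30 * (12 * r + 1) + 9 * r + 1)).toNat, by omega, rfl⟩),
        by omega⟩
  · by_cases h : -x ≤ 30 * (12 * r + 1) + 9 * r
    · exact ⟨_, Or.inr (Or.inl ⟨(-x - (30 * (12 * r + 1) + 6 * r + 1)).toNat, by omega, rfl⟩),
        by omega⟩
    · exact ⟨_, Or.inr (Or.inr ⟨(-x - (30 * (12 * r + 1) + 9 * r + 1)).toNat, by omega, rfl⟩),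
        by omega⟩

theorem exists_corner_row {r : ℕ} {t : ℤ} (h0 : 0 ≤ t) (h1 : t ≤ 12 * r)
    (ht : t % 4 = 1 ∨ t % 4 = 2) :
    (∃ p ∈ cornerQueens r, p.2 = 30 * (12 * r + 1) + t) ∧
    ∃ p ∈ cornerQueens r, p.2 = -(30 * (12 * r + 1) + t) := by
  simp only [mem_cornerQueens]
  rcases ht with ht | ht
  · exact ⟨⟨_, Or.inl (Or.inl ⟨(t / 4).toNat, by omega, rfl⟩), by omega⟩,
      ⟨_, Or.inr (Or.inl ⟨(t / 4).toNat, by omega, rfl⟩), by omega⟩⟩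
  · exact ⟨⟨_, Or.inl (Or.inr ⟨(t / 4).toNat, by omega, rfl⟩), by omega⟩,
      ⟨_, Or.inr (Or.inr ⟨(t / 4).toNat, by omega, rfl⟩), by omega⟩⟩

/-- The coarse pattern scaled by `q = 12r + 1` with each cell replaced by a block, together with
the queens in the corners. -/
noncomputable def evenQueens (r : ℕ) : Finset (ℤ × ℤ) :=
  (coarsePattern.toFinset ×ˢ queenBlock r).image (fun x =>
    ((12 * r + 1) * x.1.1 + x.2.1, (12 * r + 1) * x.1.2 + x.2.2)) ∪ cornerQueens r

theorem add_mem_evenQueens {r : ℕ} {a b i j : ℤ} (h : (a, b) ∈ coarsePattern)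
    (h' : (i, j) ∈ queenBlock r) :
    ((12 * r + 1) * a + i, (12 * r + 1) * b + j) ∈ evenQueens r :=
  Finset.mem_union_left _ (Finset.mem_image.2 ⟨((a, b), (i, j)), by simp [h, h'], rfl⟩)

theorem card_evenQueens_le (r : ℕ) : (evenQueens r).card ≤ 63 * (12 * r + 1) + 12 * r := by
  refine (Finset.card_union_le _ _).trans
    (Nat.add_le_add (Finset.card_image_le.trans ?_) (card_cornerQueens_le r))
  rw [Finset.card_product]
  exact Nat.mul_le_mul ((List.toFinset_card_le _).trans length_coarsePattern.le)
    (card_queenBlock_le r)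

theorem evenQueens_bound {r : ℕ} {p : ℤ × ℤ} (hp : p ∈ evenQueens r) :
    |p.1| ≤ 31 * (12 * r + 1) - 1 ∧ |p.2| ≤ 31 * (12 * r + 1) - 1 := by
  rcases Finset.mem_union.1 hp with hp | hp
  · obtain ⟨⟨c, f⟩, hcf, rfl⟩ := Finset.mem_image.1 hp
    rw [Finset.mem_product, List.mem_toFinset] at hcf
    have hc := coarsePattern_bound _ hcf.1
    have hf := queenBlock_bound hcf.2
    have hq : (0 : ℤ) ≤ 12 * r + 1 := by positivity
    simp only [abs_le] at hc hf ⊢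
    dsimp only at *
    refine ⟨⟨?_, ?_⟩, ?_, ?_⟩ <;> nlinarith
  · exact cornerQueens_bound hp

theorem exists_evenQueens_col {r : ℕ} {x : ℤ} (h : |x| ≤ 31 * (12 * r + 1) - 1) :
    ∃ p ∈ evenQueens r, p.1 = x := by
  by_cases hx : 30 * (12 * r + 1) + 6 * r < |x|
  · obtain ⟨p, hp, e⟩ := exists_corner_col hx h
    exact ⟨p, Finset.mem_union_right _ hp, e⟩
  have hq : (0 : ℤ) < 12 * r + 1 := by positivity
  rw [not_lt, abs_le] at hx
  have e := Int.mul_ediv_add_emod (x + 6 * r) (12 * r + 1)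
  have e0 := Int.emod_nonneg (x + 6 * r) hq.ne'
  have e1 := Int.emod_lt_of_pos (x + 6 * r) hq
  obtain ⟨b, hb⟩ := exists_coarse_col (a := (x + 6 * r) / (12 * r + 1)) (by
    rw [abs_le, Int.le_ediv_iff_mul_le hq, ← Int.lt_add_one_iff (b := 30),
      Int.ediv_lt_iff_lt_mul hq]
    constructor <;> omega)
  obtain ⟨j, hj⟩ := exists_block_col (r := r) (i := (x + 6 * r) % (12 * r + 1) - 6 * r) (by
    rw [abs_le]; omega)
  exact ⟨_, add_mem_evenQueens hb hj, by dsimp only; linarith⟩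

theorem exists_evenQueens_row {r : ℕ} {y : ℤ} (h : |y| ≤ 31 * (12 * r + 1) - 1) :
    ∃ p ∈ evenQueens r, p.2 = y := by
  have hq : (0 : ℤ) < 12 * r + 1 := by positivity
  rw [abs_le] at h
  obtain ⟨b, t, e, e0, e1⟩ : ∃ b t : ℤ, (12 * r + 1) * b + t = y ∧ 0 ≤ t ∧ t < 12 * r + 1 :=
    ⟨_, _, Int.mul_ediv_add_emod y (12 * r + 1), Int.emod_nonneg _ hq.ne',
      Int.emod_lt_of_pos _ hq⟩
  have hb0 : -31 ≤ b := by by_contra!; nlinarith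
  have hb1 : b ≤ 30 := by by_contra!; nlinarith
  rcases exists_block_row (r := r) e0 (by omega) with ⟨ht, i, hi⟩ | ⟨ht, i, hi⟩
  · by_cases hb : b = -31
    -- The row is `-(30q + (q - t))`, and `q - t ≡ 1, 2` modulo `4`.
    · obtain ⟨p, hp, ep⟩ := (exists_corner_row (r := r) (t := 12 * r + 1 - t) (by omega)
        (by subst hb; omega) (by omega)).2
      exact ⟨p, Finset.mem_union_right _ hp, by subst hb; omega⟩
    · obtain ⟨a, ha⟩ := exists_coarse_row (b := b) (by rw [abs_le]; omega)
      exact ⟨_, add_mem_evenQueens ha hi, e⟩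
  · by_cases hb : b = 30
    · obtain ⟨p, hp, ep⟩ := (exists_corner_row (r := r) e0 (by omega) ht).1
      exact ⟨p, Finset.mem_union_right _ hp, by subst hb; omega⟩
    · obtain ⟨a, ha⟩ := exists_coarse_row (b := b + 1) (by rw [abs_le]; omega)
      exact ⟨_, add_mem_evenQueens ha hi, by dsimp only; linarith⟩

/-- Division by the odd number `q = 12r + 1` with an even remainder of either sign. The quotient
has the parity of the dividend. -/
theorem exists_eq_mul_add_even (r : ℕ) (z : ℤ) :
    ∃ c s : ℤ, z = (12 * r + 1) * c + s ∧ s % 2 = 0 ∧ |s| ≤ 12 * r ∧ (z - c) % 2 = 0 := by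
  have hq : (0 : ℤ) < 12 * r + 1 := by positivity
  have e := Int.mul_ediv_add_emod z (12 * r + 1)
  have e0 := Int.emod_nonneg z hq.ne'
  have e1 := Int.emod_lt_of_pos z hq
  have key (c s : ℤ) (h : z = (12 * r + 1) * c + s) (hs : s % 2 = 0) : (z - c) % 2 = 0 := by
    have : z - c = 2 * (6 * r * c) + s := by rw [h]; ring
    omega
  by_cases hs : z % (12 * r + 1) % 2 = 0
  · exact ⟨_, _, e.symm, hs, by rw [abs_le]; omega, key _ _ e.symm hs⟩
  · have e' : z = (12 * r + 1) * (z / (12 * r + 1) + 1) + (z % (12 * r + 1) - (12 * r + 1)) := by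
      linarith
    exact ⟨_, _, e', by omega, by rw [abs_le]; omega, key _ _ e' (by omega)⟩

theorem exists_evenQueens_diff {r : ℕ} {δ : ℤ}
    (h : (δ % 2 = 0 ∧ |δ| < 15 * (12 * r + 1)) ∨ (δ % 2 = 1 ∧ |δ| < 48 * (12 * r + 1))) :
    ∃ p ∈ evenQueens r, p.1 - p.2 = δ := by
  have hq : (0 : ℤ) < 12 * r + 1 := by positivity
  obtain ⟨c, s, e, hs, hsb, hc⟩ := exists_eq_mul_add_even r δ
  have hcb : |c| ≤ 47 ∧ (c % 2 = 1 ∨ |c| ≤ 14) := by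
    simp only [abs_le, abs_lt] at *
    rcases h with ⟨hp, h⟩ | ⟨hp, h⟩
    · have h1 : -16 < c := by by_contra!; nlinarith
      have h2 : c < 16 := by by_contra!; nlinarith
      omega
    · have h1 : -49 < c := by by_contra!; nlinarith
      have h2 : c < 49 := by by_contra!; nlinarith
      omega
  obtain ⟨a, b, hab, rfl⟩ := exists_coarse_diff hcb.1 hcb.2
  obtain ⟨i, j, hij, rfl⟩ := exists_block_diff hs hsb
  exact ⟨_, add_mem_evenQueens hab hij, by dsimp only; linarith⟩

/-- The bounds are weaker than for differences, as some of the sums in a block lie beyond `q`. -/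
theorem exists_evenQueens_sum {r : ℕ} {σ : ℤ}
    (h : (σ % 2 = 0 ∧ |σ| < 14 * (12 * r + 1)) ∨ (σ % 2 = 1 ∧ |σ| < 47 * (12 * r + 1))) :
    ∃ p ∈ evenQueens r, p.1 + p.2 = σ := by
  have hq : (0 : ℤ) < 12 * r + 1 := by positivity
  obtain ⟨c, s, e, hs, hsb, hc⟩ := exists_eq_mul_add_even r σ
  obtain ⟨i, j, hij, hcase⟩ := exists_block_sum hs hsb
  suffices ∃ c', (|c'| ≤ 47 ∧ (c' % 2 = 1 ∨ |c'| ≤ 14)) ∧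
      (12 * r + 1) * c' + (i + j) = σ by
    obtain ⟨c', hc', e'⟩ := this
    obtain ⟨a, b, hab, rfl⟩ := exists_coarse_sum hc'.1 hc'.2
    exact ⟨_, add_mem_evenQueens hab hij, by dsimp only; linarith⟩
  simp only [abs_le, abs_lt] at *
  rcases hcase with hij' | ⟨hpos, hij'⟩ | ⟨hneg, hij'⟩
  · refine ⟨c, ?_, by rw [hij', e]⟩
    rcases h with ⟨hp, h⟩ | ⟨hp, h⟩
    · have h1 : -15 < c := by by_contra!; nlinarith
      have h2 : c < 15 := by by_contra!; nlinarith
      omega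
    · have h1 : -48 < c := by by_contra!; nlinarith
      have h2 : c < 48 := by by_contra!; nlinarith
      omega
  · refine ⟨c + 2, ?_, by rw [hij', e]; ring⟩
    rcases h with ⟨hp, h⟩ | ⟨hp, h⟩
    · have h1 : -15 < c := by by_contra!; nlinarith
      have h2 : c < 14 := by by_contra!; nlinarith
      omega
    · have h1 : -48 < c := by by_contra!; nlinarith
      have h2 : c < 47 := by by_contra!; nlinarith
      omega
  · refine ⟨c - 2, ?_, by rw [hij', e]; ring⟩
    rcases h with ⟨hp, h⟩ | ⟨hp, h⟩
    · have h1 : -14 < c := by by_contra!; nlinarith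
      have h2 : c < 15 := by by_contra!; nlinarith
      omega
    · have h1 : -47 < c := by by_contra!; nlinarith
      have h2 : c < 48 := by by_contra!; nlinarith
      omega

/-! ### The linear bound -/

/-- With `q = 12r + 1`, a board of side `124q - 1` is dominated by `64q - 1` queens. -/
theorem dominationNumber_queenGraph_two_le_of_ge {r n : ℕ} (hn : 1488 * r + 123 ≤ n) :
    dominationNumber (queenGraph 2 n) ≤ 768 * r + 63 + (n - (1488 * r + 123)) := by
  have hA : ((372 * r + 30 : ℕ) : ℤ) = 31 * (12 * r + 1) - 1 := by push_cast; ring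
  have h := dominationNumber_queenGraph_two_le_of_even_squares (A := 372 * r + 30) (n := n)
    (by omega) (evenQueens r) (fun p hp => hA ▸ evenQueens_bound hp)
    (fun x hx => exists_evenQueens_col (hA ▸ hx)) (fun y hy => exists_evenQueens_row (hA ▸ hy)) ?_
  · have := card_evenQueens_le r
    omega
  intro δ σ hb hp
  rw [hA] at hb
  -- An uncovered even (odd) `δ` is at least `15q` (`48q`) in absolute value, which leaves
  -- `|σ| < 47q` (`|σ| < 14q`).
  by_cases hδ : (δ % 2 = 0 ∧ |δ| < 15 * (12 * r + 1)) ∨ (δ % 2 = 1 ∧ |δ| < 48 * (12 * r + 1))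
  · obtain ⟨p, hp, e⟩ := exists_evenQueens_diff hδ
    exact ⟨p, hp, Or.inl e⟩
  · obtain ⟨p, hp, e⟩ := exists_evenQueens_sum (r := r) (σ := σ) (by omega)
    exact ⟨p, hp, Or.inr e⟩

/-- A diagonal of queens dominates the board. -/
theorem dominationNumber_queenGraph_two_le_self (n : ℕ) :
    dominationNumber (queenGraph 2 n) ≤ n := by
  classical
  refine (dominationNumber_queenGraph_two_le ((Finset.Ico (0 : ℤ) n).image fun t => (t, t))
    ?_ ?_).trans (Finset.card_image_le.trans (by simp))
  · intro p hp
    obtain ⟨t, ht, rfl⟩ := Finset.mem_image.1 hp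
    exact ⟨Finset.mem_Ico.1 ht, Finset.mem_Ico.1 ht⟩
  · intro x y hx0 hxn _ _
    exact ⟨(x, x), Finset.mem_image.2 ⟨x, Finset.mem_Ico.2 ⟨hx0, hxn⟩, rfl⟩, Or.inl rfl⟩

theorem theorem5 :
    (∀ n : ℕ, dominationNumber (queenGraph 3 n) ≤ n * dominationNumber (queenGraph 2 n)) ∧
    (∃ C : ℝ, ∀ n : ℕ, (n : ℝ) * (dominationNumber (queenGraph 2 n) : ℝ) ≤
      69 / 133 * (n : ℝ) ^ 2 + C * (n : ℝ)) := by
  refine ⟨dominationNumber_queenGraph_three_le, 1551, fun n => ?_⟩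
  have key : 133 * dominationNumber (queenGraph 2 n) ≤ 69 * n + 133 * 1551 := by
    by_cases hn : n < 123
    · have := dominationNumber_queenGraph_two_le_self n
      omega
    · have := dominationNumber_queenGraph_two_le_of_ge (r := (n - 123) / 1488) (n := n) (by omega)
      omega
  have key' : 133 * (dominationNumber (queenGraph 2 n) : ℝ) ≤ 69 * n + 133 * 1551 := by
    exact_mod_cast key
  nlinarith [mul_le_mul_of_nonneg_left key' n.cast_nonneg]
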